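/- Let $\mathsf P$ be a countably infinite set of propositional variables and let $\mathscr L$ be the language $\varphi ::= p \mid \neg\varphi \mid \varphi\wedge\varphi \mid \Box_0\varphi \mid \Box\varphi \mid \forall\varphi$ ($p\in\mathsf P$), with $\bot := p\wedge\neg p$, $\top := \neg\bot$ and the other Boolean connectives defined as usual. **Models.** An ordered family on a set $W$ is a pair $\langle\mathscr R,\preceq\rangle$ where $\mathscr R$ is a set of preorders on $W$ and $\preceq$ is a preorder on $\mathscr R$. An aggregator for $W$ is a function $Ag$ that maps every ordered family on $W$ to a preorder on $W$. A relational evidence model $M=\langle W,\langle\mathscr R,\preceq\rangle,V,Ag\rangle$ consists of a non-empty set $W$, an ordered family on $W$ with $W\times W\in\mathscr R$, a valuation $V:\mathsf P\to 2^W$ and an aggregator $Ag$ for $W$. Variables and Booleans are interpreted as usual; $M,w\models\Box_0\varphi$ iff there is $R\in\mathscr R$ such that $M,v\models\varphi$ for all $v$ with $Rwv$; $M,w\models\Box\varphi$ iff $M,v\models\varphi$ for all $v$ with $Ag(\langle\mathscr R,\preceq\rangle)wv$; $M,w\models\forall\varphi$ iff $M,v\models\varphi$ for all $v\in W$. Put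 $(w,v)\in Ag_\cap(\langle\mathscr R,\preceq\rangle)$ iff $(w,v)\in\bigcap\mathscr R$, and $(w,v)\in\mathsf{lex}(\langle\mathscr R,\preceq\rangle)$ iff for every $R'\in\mathscr R$: $R'wv$, or there is $R\in\mathscr R$ with $R'\preceq R$, $R\not\preceq R'$, $Rwv$ and not $Rvw$. The model $M$ is a $\cap$-model if $Ag=Ag_\cap$. It is a $\mathsf{lex}$-model if $\mathsf{lex}(\langle\mathscr R,\preceq\rangle)$ is a preorder and $Ag(P)=\mathsf{lex}(P)$ for every ordered family $P$ on $W$ for which $\mathsf{lex}(P)$ is a preorder. **Systems.** Both $\mathsf L_\cap$ and $\mathsf L_{\mathsf{lex}}$ have as axioms all propositional tautologies, the $\mathsf{S5}$ axioms for $\forall$, the $\mathsf{S4}$ axioms for $\Box$, $\Box_0\varphi\to\Box_0\Box_0\varphi$, $\forall\varphi\to\Box_0\varphi$ and $(\Box_0\varphi\wedge\forall\psi)\leftrightarrow\Box_0(\varphi\wedge\forall\psi)$, and as rules modus ponens, necessitation for $\forall$ and for $\Box$, and monotonicity for $\Box_0$ (from $\varphi\to\psi$ infer $\Box_0\varphi\to\Box_0\psi$).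 In addition, $\mathsf L_\cap$ has the axiom $\Box_0\varphi\to\Box\varphi$, and $\mathsf L_{\mathsf{lex}}$ has the axioms $\Box_0\varphi\to\varphi$, $\Box_0\top$ and $\forall\varphi\to\Box\varphi$. **Theorem.** $\mathsf L_\cap$ is sound and strongly complete with respect to $\cap$-models, and $\mathsf L_{\mathsf{lex}}$ is sound and strongly complete with respect to $\mathsf{lex}$-models. That is, for each of the two systems with its class of models: every theorem of the system is true at every state of every model of the class; and for every (possibly infinite) set $\Gamma\subseteq\mathscr L$ and every $\varphi\in\mathscr L$, if $\varphi$ is true at every state of every model of the class at which all members of $\Gamma$ are true, then $\varphi$ is deducible from $\Gamma$ in the system, i.e. for some $\gamma_1,\dots,\gamma_n\in\Gamma$ ($n\ge 0$) the formula $\gamma_1\to(\gamma_2\to\cdots(\gamma_n\to\varphi))$ is a theorem. -/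

import Mathlib

universe u

namespace REL

/-! ### Syntax -/

/-- Formulas over the propositional variables `P`, with the modalities
`□₀` (`box0`), `□` (`box`) and `∀` (`all`). -/
inductive Form (P : Type) : Type
  | var (p : P) : Form P
  | neg (φ : Form P) : Form P
  | and (φ ψ : Form P) : Form P
  | box0 (φ : Form P) : Form P
  | box (φ : Form P) : Form P
  | all (φ : Form P) : Form P

namespace Form

variable {P : Type}

/-- `φ → ψ`, i.e. `¬(φ ∧ ¬ψ)`. -/
def imp (φ ψ : Form P) : Form P := neg (and φ (neg ψ))

/-- `φ ↔ ψ`. -/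
def iff (φ ψ : Form P) : Form P := and (imp φ ψ) (imp ψ φ)

/-- `⊥ := p ∧ ¬p`. -/
def bot (p : P) : Form P := and (var p) (neg (var p))

/-- `⊤ := ¬⊥`. -/
def top (p : P) : Form P := neg (bot p)

end Form

open Form

/-! ### The proof systems -/

/-- A tautology of propositional logic: true under every Boolean valuation of the formulas,
where variables and formulas starting with a modality are treated as atoms. -/
def Tautology {P : Type} (φ : Form P) : Prop :=
  ∀ v : Form P → Prop,
    (∀ ψ, v (neg ψ) ↔ ¬ v ψ) → (∀ ψ χ, v (and ψ χ) ↔ (v ψ ∧ v χ)) → v φ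

/-- The axioms common to both systems. -/
inductive CommonAx {P : Type} : Form P → Prop
  | taut (φ : Form P) : Tautology φ → CommonAx φ
  | allK (φ ψ : Form P) : CommonAx (imp (all (imp φ ψ)) (imp (all φ) (all ψ)))
  | allT (φ : Form P) : CommonAx (imp (all φ) φ)
  | all4 (φ : Form P) : CommonAx (imp (all φ) (all (all φ)))
  | all5 (φ : Form P) : CommonAx (imp (neg (all φ)) (all (neg (all φ))))
  | boxK (φ ψ : Form P) : CommonAx (imp (box (imp φ ψ)) (imp (box φ) (box ψ)))
  | boxT (φ : Form P) : CommonAx (imp (box φ) φ)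
  | box4 (φ : Form P) : CommonAx (imp (box φ) (box (box φ)))
  | box0four (φ : Form P) : CommonAx (imp (box0 φ) (box0 (box0 φ)))
  | universality0 (φ : Form P) : CommonAx (imp (all φ) (box0 φ))
  | pullout (φ ψ : Form P) :
      CommonAx (iff (and (box0 φ) (all ψ)) (box0 (and φ (all ψ))))

/-- The axioms of `L_∩`. -/
inductive CapAx {P : Type} : Form P → Prop
  | common (φ : Form P) : CommonAx φ → CapAx φ
  | box0_box (φ : Form P) : CapAx (imp (box0 φ) (box φ))

/-- The axioms of `L_lex`. -/
inductive LexAx {P : Type} : Form P → Prop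
  | common (φ : Form P) : CommonAx φ → LexAx φ
  | box0T (φ : Form P) : LexAx (imp (box0 φ) φ)
  | box0N (p : P) : LexAx (box0 (top p))
  | universality (φ : Form P) : LexAx (imp (all φ) (box φ))

/-- Theorems of the system with axioms `Ax` and the rules shared by both systems: modus ponens,
necessitation for `∀` and `□`, monotonicity for `□₀`. -/
inductive Provable {P : Type} (Ax : Form P → Prop) : Form P → Prop
  | ax {φ : Form P} : Ax φ → Provable Ax φ
  | mp {φ ψ : Form P} : Provable Ax (imp φ ψ) → Provable Ax φ → Provable Ax ψ
  | necAll {φ : Form P} : Provable Ax φ → Provable Ax (all φ)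
  | necBox {φ : Form P} : Provable Ax φ → Provable Ax (box φ)
  | monoBox0 {φ ψ : Form P} : Provable Ax (imp φ ψ) → Provable Ax (imp (box0 φ) (box0 ψ))

/-- `φ` is deducible from `Γ`: for some `γ₁, …, γₙ ∈ Γ` (`n ≥ 0`), the formula
`γ₁ → (γ₂ → ⋯ (γₙ → φ))` is a theorem. -/
def Deducible {P : Type} (Ax : Form P → Prop) (Γ : Set (Form P)) (φ : Form P) : Prop :=
  ∃ l : List (Form P), (∀ γ ∈ l, γ ∈ Γ) ∧ Provable Ax (l.foldr imp φ)

/-! ### Relational evidence models -/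

/-- A preordered family of evidence orders on `W`: a set of preorders on `W` together with a
preorder (the priority order) on that set; `prio R R'` says that `R'` has at least the priority
of `R`. -/
structure OrderedFamily (W : Type u) where
  evid : Set (W → W → Prop)
  evid_preorder : ∀ R ∈ evid, IsPreorder W R
  prio : evid → evid → Prop
  prio_preorder : IsPreorder evid prio

/-- An evidence aggregator for `W`: a function from ordered families of evidence on `W` to
preorders on `W`. -/
abbrev Aggregator (W : Type u) : Type u :=
  OrderedFamily W → {Q : W → W → Prop // IsPreorder W Q}

/-- The intersection of all evidence orders of the family. -/
def capRel {W : Type u} (F : OrderedFamily W) (w v : W) : Prop :=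
  ∀ R ∈ F.evid, R w v

theorem capRel_preorder {W : Type u} (F : OrderedFamily W) : IsPreorder W (capRel F) where
  refl w R hR := (F.evid_preorder R hR).refl w
  trans w v x hwv hvx R hR := (F.evid_preorder R hR).trans w v x (hwv R hR) (hvx R hR)

/-- The intersection rule. -/
def capAgg (W : Type u) : Aggregator W := fun F => ⟨capRel F, capRel_preorder F⟩

/-- The (anti-)lexicographic rule, as a relation: every evidence order `R'` either relates `w` to
`v` or is overruled by an evidence order of strictly higher priority that strictly prefers
`v` to `w`. -/
def lexRel {W : Type u} (F : OrderedFamily W) (w v : W) : Prop :=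
  ∀ R' : F.evid, R'.1 w v ∨
    ∃ R : F.evid, (F.prio R' R ∧ ¬ F.prio R R') ∧ (R.1 w v ∧ ¬ R.1 v w)

/-- Relational evidence models. -/
structure Model (P : Type) where
  W : Type u
  nonempty : Nonempty W
  fam : OrderedFamily W
  trivial_mem : (fun _ _ : W => True) ∈ fam.evid
  val : P → Set W
  agg : Aggregator W

/-- Satisfaction. -/
def Model.Sat {P : Type} (M : Model.{u} P) : M.W → Form P → Prop
  | w, .var p => w ∈ M.val p
  | w, .neg φ => ¬ M.Sat w φ
  | w, .and φ ψ => M.Sat w φ ∧ M.Sat w ψ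
  | w, .box0 φ => ∃ R ∈ M.fam.evid, ∀ v, R w v → M.Sat v φ
  | w, .box φ => ∀ v, (M.agg M.fam).1 w v → M.Sat v φ
  | _, .all φ => ∀ v, M.Sat v φ

/-- `∩`-models: the aggregator is the intersection rule. -/
def Model.IsCap {P : Type} (M : Model.{u} P) : Prop :=
  M.agg = capAgg M.W

/-- `lex`-models: the aggregator is the lexicographic rule. Over an infinite set of states
the relation `lexRel F` can fail to be transitive for an infinite family `F`, so the rule is an
aggregator on those families on which it returns a preorder, and the family of the model
has to be one of them. -/
def Model.IsLex {P : Type} (M : Model.{u} P) : Prop :=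
  IsPreorder M.W (lexRel M.fam) ∧
    ∀ F : OrderedFamily M.W, IsPreorder M.W (lexRel F) → (M.agg F).1 = lexRel F

/-- `φ` is valid on the class `C` of models. -/
def Valid {P : Type} (C : Model.{u} P → Prop) (φ : Form P) : Prop :=
  ∀ M : Model.{u} P, C M → ∀ w : M.W, M.Sat w φ

/-- `φ` is a (local) semantic consequence of `Γ` over the class `C` of models. -/
def Consequence {P : Type} (C : Model.{u} P → Prop) (Γ : Set (Form P)) (φ : Form P) : Prop :=
  ∀ M : Model.{u} P, C M → ∀ w : M.W, (∀ γ ∈ Γ, M.Sat w γ) → M.Sat w φ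

/-- Soundness with respect to a class of models. -/
def Sound {P : Type} (Ax : Form P → Prop) (C : Model.{u} P → Prop) : Prop :=
  ∀ φ : Form P, Provable Ax φ → Valid C φ

/-- Strong completeness with respect to a class of models. -/
def StronglyComplete {P : Type} (Ax : Form P → Prop) (C : Model.{u} P → Prop) : Prop :=
  ∀ (Γ : Set (Form P)) (φ : Form P), Consequence C Γ φ → Deducible Ax Γ φ

end REL

/-!
Soundness is checked axiom by axiom. Completeness is proved by a canonical model, and a single
frame serves both systems.

Fix a maximal theory `T₀` and let the worlds be the maximal theories with the same `∀`-formulas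
as `T₀`, with the usual canonical relation `S ≤ S'` for `□` (if `□φ ∈ S` then `φ ∈ S'`).
For `□₀` the preorders `R_ψ`, "if `□₀ψ` holds at `w` then it holds at `v`", are the right
evidence: `R_ψ` sees from a world satisfying `□₀ψ` exactly the extension of `□₀ψ`, and the pullout
axiom together with `□₀ψ → □₀□₀ψ` turns an inclusion of that extension in the extension of `φ`
into `□₀φ` (`IsMaximal.box0_mem_of_forall`). However, these preorders do not aggregate to `≤`.

The remedy is to take copies of the worlds, indexed by a time in `ℕ` and a side in `Bool`.
Time makes `≤` antisymmetric: a step either stays put or moves along `≤` to a strictly later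
time, giving a partial order `Point.le` for which `□` is still the box. For each side `b` there is
an evidence order `Point.guard b`, under which one may move to any point of side `b`, or follow
`Point.le` within the other side. Each guard order sees a copy of every world, so it supports `□₀φ`
only when `∀φ` holds. But a pair related by both guard orders has to stay on one side and follow
`Point.le`. So the guard orders intersect exactly in `Point.le`.

For the intersection rule, `□₀φ → □φ` makes `≤` a subrelation of every `R_ψ`, and the whole family
intersects in `Point.le` (`capRel_canonicalFamily`). For the lexicographic rule, the guard orders
get priority over all other evidence; since `Point.le` is antisymmetric, a nontrivial step of it is
strict for one of the guard orders and overrules any `R_ψ` against it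
(`lexRel_canonicalFamily`). One truth lemma (`sat_canonicalModel`) then covers both cases.
-/

namespace REL

open Form

variable {P : Type} {Ax : Form P → Prop}

/-! ### Soundness -/

theorem Model.sat_imp (M : Model.{u} P) (w : M.W) (φ ψ : Form P) :
    M.Sat w (imp φ ψ) ↔ (M.Sat w φ → M.Sat w ψ) := by
  simp only [imp, Model.Sat]
  tauto

theorem CommonAx.sat {φ : Form P} (h : CommonAx φ) (M : Model.{u} P) (w : M.W) :
    M.Sat w φ := by
  have hagg := (M.agg M.fam).2
  cases h with
  | taut φ h => exact h (M.Sat w) (fun _ => Iff.rfl) (fun _ _ => Iff.rfl)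
  | allK φ ψ =>
    simp only [Model.sat_imp, Model.Sat]
    exact fun h h' v => h v (h' v)
  | allT φ =>
    simp only [Model.sat_imp, Model.Sat]
    exact fun h => h w
  | all4 φ =>
    simp only [Model.sat_imp, Model.Sat]
    exact fun h _ => h
  | all5 φ =>
    simp only [Model.sat_imp, Model.Sat]
    exact fun h _ => h
  | boxK φ ψ =>
    simp only [Model.sat_imp, Model.Sat]
    exact fun h h' v hv => h v hv (h' v hv)
  | boxT φ =>
    simp only [Model.sat_imp, Model.Sat]
    exact fun h => h w (hagg.refl w)
  | box4 φ =>
    simp only [Model.sat_imp, Model.Sat]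
    exact fun h v hv x hx => h x (hagg.trans w v x hv hx)
  | box0four φ =>
    simp only [Model.sat_imp, Model.Sat]
    rintro ⟨R, hR, h⟩
    exact ⟨R, hR, fun v hv => ⟨R, hR, fun x hx =>
      h x ((M.fam.evid_preorder R hR).trans w v x hv hx)⟩⟩
  | universality0 φ =>
    simp only [Model.sat_imp, Model.Sat]
    exact fun h => ⟨_, M.trivial_mem, fun v _ => h v⟩
  | pullout φ ψ =>
    simp only [Form.iff, Model.Sat, Model.sat_imp]
    constructor
    · rintro ⟨⟨R, hR, h⟩, h'⟩
      exact ⟨R, hR, fun v hv => ⟨h v hv, h'⟩⟩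
    · rintro ⟨R, hR, h⟩
      exact ⟨⟨R, hR, fun v hv => (h v hv).1⟩, (h w ((M.fam.evid_preorder R hR).refl w)).2⟩

theorem sound_of_axioms_valid {C : Model.{u} P → Prop} (hAx : ∀ φ, Ax φ → Valid C φ) :
    Sound Ax C := by
  intro φ h M hM
  induction h with
  | ax h => exact hAx _ h M hM
  | mp _ _ ih₁ ih₂ => exact fun w => (M.sat_imp w _ _).1 (ih₁ w) (ih₂ w)
  | necAll _ ih => exact fun _ v => ih v
  | necBox _ ih => exact fun _ v _ => ih v
  | monoBox0 _ ih =>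
    intro w
    rw [Model.sat_imp]
    rintro ⟨R, hR, h⟩
    exact ⟨R, hR, fun v hv => (M.sat_imp v _ _).1 (ih v) (h v hv)⟩

theorem sound_cap : Sound (P := P) CapAx Model.IsCap.{u} := by
  refine sound_of_axioms_valid fun φ h M hM w => ?_
  cases h with
  | common _ h => exact h.sat M w
  | box0_box φ =>
    rw [Model.sat_imp]
    rintro ⟨R, hR, h⟩ v hv
    rw [hM] at hv
    exact h v (hv R hR)

theorem sound_lex : Sound (P := P) LexAx Model.IsLex.{u} := by
  refine sound_of_axioms_valid fun φ h M _ w => ?_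
  cases h with
  | common _ h => exact h.sat M w
  | box0T φ =>
    rw [Model.sat_imp]
    rintro ⟨R, hR, h⟩
    exact h w ((M.fam.evid_preorder R hR).refl w)
  | box0N p => exact ⟨_, M.trivial_mem, fun v _ h => h.2 h.1⟩
  | universality φ =>
    rw [Model.sat_imp]
    exact fun h v _ => h v

/-! ### Deducibility -/

/-- `v` respects the Boolean connectives; variables and modal formulas are treated as atoms. -/
def IsBoolean (v : Form P → Prop) : Prop :=
  (∀ ψ, v (neg ψ) ↔ ¬ v ψ) ∧ ∀ ψ χ, v (and ψ χ) ↔ (v ψ ∧ v χ)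

theorem IsBoolean.imp_iff {v : Form P → Prop} (hv : IsBoolean v) (φ ψ : Form P) :
    v (imp φ ψ) ↔ (v φ → v ψ) := by
  rw [imp, hv.1, hv.2, hv.1]
  tauto

theorem IsBoolean.foldr_iff {v : Form P → Prop} (hv : IsBoolean v) (l : List (Form P))
    (φ : Form P) : v (l.foldr imp φ) ↔ ((∀ γ ∈ l, v γ) → v φ) := by
  induction l with
  | nil => simp
  | cons γ l ih => simp [hv.imp_iff, ih]

theorem provable_of_boolean (hC : ∀ φ, CommonAx φ → Ax φ) {φ : Form P}
    (h : ∀ v, IsBoolean v → v φ) : Provable Ax φ :=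
  .ax (hC _ (.taut _ fun v h₁ h₂ => h v ⟨h₁, h₂⟩))

theorem Provable.boolean (hC : ∀ φ, CommonAx φ → Ax φ) {φ ψ : Form P} (hφ : Provable Ax φ)
    (h : ∀ v, IsBoolean v → v φ → v ψ) : Provable Ax ψ :=
  .mp (provable_of_boolean hC fun v hv => (hv.imp_iff _ _).2 (h v hv)) hφ

theorem Provable.boolean₂ (hC : ∀ φ, CommonAx φ → Ax φ) {φ ψ χ : Form P} (hφ : Provable Ax φ)
    (hψ : Provable Ax ψ) (h : ∀ v, IsBoolean v → v φ → v ψ → v χ) : Provable Ax χ :=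
  .mp (hφ.boolean hC fun v hv hvφ => (hv.imp_iff _ _).2 (h v hv hvφ)) hψ

theorem deducible_of_mem (hC : ∀ φ, CommonAx φ → Ax φ) {Γ : Set (Form P)} {φ : Form P}
    (h : φ ∈ Γ) : Deducible Ax Γ φ :=
  ⟨[φ], by simpa using h, provable_of_boolean hC fun v hv => (hv.imp_iff _ _).2 id⟩

theorem Provable.deducible {φ : Form P} (h : Provable Ax φ) (Γ : Set (Form P)) :
    Deducible Ax Γ φ :=
  ⟨[], by simp, h⟩

theorem Deducible.boolean₂ (hC : ∀ φ, CommonAx φ → Ax φ) {Γ : Set (Form P)} {φ ψ χ : Form P}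
    (hφ : Deducible Ax Γ φ) (hψ : Deducible Ax Γ ψ)
    (h : ∀ v, IsBoolean v → v φ → v ψ → v χ) : Deducible Ax Γ χ := by
  obtain ⟨l₁, hl₁, h₁⟩ := hφ
  obtain ⟨l₂, hl₂, h₂⟩ := hψ
  refine ⟨l₁ ++ l₂, fun γ hγ => (List.mem_append.1 hγ).elim (hl₁ γ) (hl₂ γ),
    h₁.boolean₂ hC h₂ fun v hv => ?_⟩
  simp only [hv.foldr_iff]
  intro a b c
  exact h v hv (a fun γ hγ => c γ (List.mem_append_left _ hγ))
    (b fun γ hγ => c γ (List.mem_append_right _ hγ))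

/-- The deduction theorem. -/
theorem Deducible.imp_of_insert (hC : ∀ φ, CommonAx φ → Ax φ) {Γ : Set (Form P)}
    {φ ψ : Form P} (h : Deducible Ax (insert φ Γ) ψ) : Deducible Ax Γ (imp φ ψ) := by
  classical
  obtain ⟨l, hl, h⟩ := h
  refine ⟨l.filter (· ≠ φ), fun γ hγ => ?_, h.boolean hC fun v hv => ?_⟩
  · simp only [ne_eq, decide_not, List.mem_filter, Bool.not_eq_eq_eq_not, Bool.not_true,
      decide_eq_false_iff_not] at hγ
    exact (hl γ hγ.1).resolve_left hγ.2
  · simp only [hv.foldr_iff, hv.imp_iff]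
    intro a b c
    refine a fun γ hγ => ?_
    by_cases e : γ = φ
    · exact e ▸ c
    · exact b γ (by simp [hγ, e])

/-! ### Maximal theories -/

/-- Maximal consistent sets, in the form in which they are used: deductively closed sets that
contain exactly one of `φ` and `¬φ` for every `φ`. -/
structure IsMaximal (Ax : Form P → Prop) (T : Set (Form P)) : Prop where
  closed : ∀ φ, Deducible Ax T φ → φ ∈ T
  neg_mem_iff : ∀ φ, neg φ ∈ T ↔ φ ∉ T

/-- Lindenbaum's lemma. A set that is maximal among those not deducing `φ` is maximal
consistent. -/
theorem exists_isMaximal (hC : ∀ φ, CommonAx φ → Ax φ) {Γ : Set (Form P)} {φ : Form P}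
    (h : ¬ Deducible Ax Γ φ) : ∃ T, IsMaximal Ax T ∧ Γ ⊆ T ∧ φ ∉ T := by
  obtain ⟨T, hΓT, hT⟩ := zorn_subset_nonempty {T | ¬ Deducible Ax T φ} (by
    rintro c hc hchain ⟨T₁, hT₁⟩
    refine ⟨⋃₀ c, ?_, fun s hs => Set.subset_sUnion_of_mem hs⟩
    rintro ⟨l, hl, hprov⟩
    -- the finitely many premises of a deduction already lie in one member of the chain
    obtain ⟨T, hT, hlT⟩ := hchain.directedOn.exists_mem_subset_of_finite_of_subset_sUnion
      ⟨T₁, hT₁⟩ (s := {γ | γ ∈ l}) (List.finite_toSet l) hl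
    exact hc hT ⟨l, hlT, hprov⟩) Γ h
  have hins : ∀ ψ, ψ ∉ T → Deducible Ax T (imp ψ φ) := by
    intro ψ hψ
    refine Deducible.imp_of_insert hC (by_contra fun hn => hψ ?_)
    exact hT.le_of_ge (y := insert ψ T) hn (Set.subset_insert _ _) (Set.mem_insert _ _)
  refine ⟨T, ⟨fun ψ hψ => by_contra fun hn => hT.prop ?_, fun ψ => ⟨fun h₁ h₂ => hT.prop ?_,
    fun h₁ => by_contra fun h₂ => hT.prop ?_⟩⟩, hΓT, fun h' => hT.prop (deducible_of_mem hC h')⟩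
  · exact (hins ψ hn).boolean₂ hC hψ fun v hv a b => (hv.imp_iff _ _).1 a b
  · exact (deducible_of_mem hC h₁).boolean₂ hC (deducible_of_mem hC h₂) fun v hv a b =>
      absurd b ((hv.1 _).1 a)
  · refine (hins ψ h₁).boolean₂ hC (hins _ h₂) fun v hv a b => ?_
    rw [hv.imp_iff] at a b
    rw [hv.1] at b
    tauto

namespace IsMaximal

variable {T : Set (Form P)}

theorem mem_of_provable (hT : IsMaximal Ax T) {φ : Form P} (h : Provable Ax φ) : φ ∈ T :=
  hT.closed _ (h.deducible T)

theorem isBoolean (hC : ∀ φ, CommonAx φ → Ax φ) (hT : IsMaximal Ax T) :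
    IsBoolean (· ∈ T) := by
  refine ⟨hT.neg_mem_iff, fun ψ χ => ⟨fun h => ?_, fun h => ?_⟩⟩
  · have h := deducible_of_mem hC h
    exact ⟨hT.closed _ (h.boolean₂ hC h fun v hv a _ => ((hv.2 _ _).1 a).1),
      hT.closed _ (h.boolean₂ hC h fun v hv a _ => ((hv.2 _ _).1 a).2)⟩
  · exact hT.closed _ ((deducible_of_mem hC h.1).boolean₂ hC (deducible_of_mem hC h.2)
      fun v hv a b => (hv.2 _ _).2 ⟨a, b⟩)

theorem mem_of_imp (hC : ∀ φ, CommonAx φ → Ax φ) (hT : IsMaximal Ax T) {φ ψ : Form P}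
    (h : Provable Ax (imp φ ψ)) (hφ : φ ∈ T) : ψ ∈ T :=
  ((hT.isBoolean hC).imp_iff φ ψ).1 (hT.mem_of_provable h) hφ

theorem mem_of_common (hC : ∀ φ, CommonAx φ → Ax φ) (hT : IsMaximal Ax T) {φ ψ : Form P}
    (h : CommonAx (imp φ ψ)) (hφ : φ ∈ T) : ψ ∈ T :=
  hT.mem_of_imp hC (.ax (hC _ h)) hφ

end IsMaximal

theorem provable_of_forall_isMaximal (hC : ∀ φ, CommonAx φ → Ax φ) {φ : Form P}
    (h : ∀ T, IsMaximal Ax T → φ ∈ T) : Provable Ax φ := by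
  by_contra hn
  obtain ⟨T, hT, -, hφ⟩ := exists_isMaximal (Ax := Ax) (Γ := ∅) (φ := φ) hC (by
    rintro ⟨l, hl, hprov⟩
    rw [List.eq_nil_iff_forall_not_mem.2 hl] at hprov
    exact hn hprov)
  exact hφ (h T hT)

namespace IsMaximal

variable {T : Set (Form P)}

/-- The existence lemma, for any normal modality `m` (it is used for `∀` and for `□`). -/
theorem exists_of_notMem (hC : ∀ φ, CommonAx φ → Ax φ) (m : Form P → Form P)
    (nec : ∀ {φ}, Provable Ax φ → Provable Ax (m φ))
    (hK : ∀ φ ψ, CommonAx (imp (m (imp φ ψ)) (imp (m φ) (m ψ))))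
    (hT : IsMaximal Ax T) {φ : Form P} (hφ : m φ ∉ T) :
    ∃ S, IsMaximal Ax S ∧ (∀ ψ, m ψ ∈ T → ψ ∈ S) ∧ φ ∉ S := by
  refine exists_isMaximal hC (Γ := {ψ | m ψ ∈ T}) ?_
  rintro ⟨l, hl, hprov⟩
  refine hφ ?_
  have hmem : m (l.foldr imp φ) ∈ T := hT.mem_of_provable (nec hprov)
  clear hprov hφ
  induction l with
  | nil => exact hmem
  | cons γ l ih =>
    refine ih (fun δ hδ => hl δ (List.mem_cons_of_mem _ hδ)) ?_
    exact ((hT.isBoolean hC).imp_iff _ _).1 (hT.mem_of_common hC (hK _ _) hmem)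
      (hl γ List.mem_cons_self)

theorem all_mem_iff (hC : ∀ φ, CommonAx φ → Ax φ) (hT : IsMaximal Ax T) {S : Set (Form P)}
    (hS : IsMaximal Ax S) (h : ∀ ψ, all ψ ∈ T → ψ ∈ S) (ψ : Form P) :
    all ψ ∈ S ↔ all ψ ∈ T := by
  refine ⟨fun h₁ => by_contra fun h₂ => ?_, fun h₁ => h _ (hT.mem_of_common hC (.all4 _) h₁)⟩
  have h₃ := h _ (hT.mem_of_common hC (.all5 _) ((hT.neg_mem_iff _).2 h₂))
  exact (hS.neg_mem_iff _).1 h₃ h₁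

theorem exists_of_all_notMem (hC : ∀ φ, CommonAx φ → Ax φ) (hT : IsMaximal Ax T) {φ : Form P}
    (hφ : all φ ∉ T) :
    ∃ S, IsMaximal Ax S ∧ (∀ ψ, all ψ ∈ S ↔ all ψ ∈ T) ∧ φ ∉ S := by
  obtain ⟨S, hS, h, hφS⟩ := hT.exists_of_notMem hC all .necAll .allK hφ
  exact ⟨S, hS, hT.all_mem_iff hC hS h, hφS⟩

/-- If `□₀ψ` entails `φ` at all worlds of the canonical model, then `□₀ψ` yields `□₀φ`. -/
theorem box0_mem_of_forall (hC : ∀ φ, CommonAx φ → Ax φ) (hT : IsMaximal Ax T) {φ ψ : Form P}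
    (hψ : box0 ψ ∈ T)
    (h : ∀ S, IsMaximal Ax S → (∀ χ, all χ ∈ S ↔ all χ ∈ T) → box0 ψ ∈ S → φ ∈ S) :
    box0 φ ∈ T := by
  have hall : all (imp (box0 ψ) φ) ∈ T := by
    by_contra hn
    obtain ⟨S, hS, hST, hnS⟩ := hT.exists_of_all_notMem hC hn
    exact hnS (((hS.isBoolean hC).imp_iff _ _).2 (h S hS hST))
  have hpull := hT.mem_of_provable (.ax (hC _ (.pullout (box0 ψ) (imp (box0 ψ) φ))))
  have hB := hT.isBoolean hC
  refine hT.mem_of_imp hC (.monoBox0 ?_) ((hB.imp_iff _ _).1 ((hB.2 _ _).1 hpull).1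
    ((hB.2 _ _).2 ⟨hT.mem_of_common hC (.box0four _) hψ, hall⟩))
  refine provable_of_forall_isMaximal hC fun S hS => ?_
  have hB := hS.isBoolean hC
  refine (hB.imp_iff _ _).2 fun h => ?_
  obtain ⟨h₁, h₂⟩ := (hB.2 _ _).1 h
  exact (hB.imp_iff _ _).1 (hS.mem_of_common hC (.allT _) h₂) h₁

end IsMaximal

/-! ### The canonical model -/

/-- Points of the canonical model based on `T₀`: maximal theories with the `∀`-formulas of `T₀`,
tagged with a time and a side. The universe of the type is free, so that the model can live in
any prescribed universe. -/
structure Point (Ax : Form P → Prop) (T₀ : Set (Form P)) : Type u where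
  th : Set (Form P)
  isMaximal : IsMaximal Ax th
  all_mem : ∀ ψ, all ψ ∈ th ↔ all ψ ∈ T₀
  time : ℕ
  side : Bool

namespace Point

variable {T₀ : Set (Form P)}

/-- The unravelled accessibility relation of `□`: stay put, or move along the canonical
relation to a strictly later time on the same side. -/
def le (x y : Point.{u} Ax T₀) : Prop :=
  x = y ∨ (x.time < y.time ∧ x.side = y.side ∧ ∀ ψ, box ψ ∈ x.th → ψ ∈ y.th)

/-- The guard order of side `b`: every point of side `b` is accessible, and points of the other
side are accessible by `Point.le`. -/
def guard (b : Bool) (x y : Point.{u} Ax T₀) : Prop :=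
  y.side = b ∨ x.le y

/-- The evidence order of `ψ`: truth of `□₀ψ` is preserved. -/
def support (ψ : Form P) (x y : Point.{u} Ax T₀) : Prop :=
  box0 ψ ∈ x.th → box0 ψ ∈ y.th

theorem le_refl (x : Point.{u} Ax T₀) : x.le x := Or.inl rfl

theorem le_trans (hC : ∀ φ, CommonAx φ → Ax φ) {x y z : Point.{u} Ax T₀} (hxy : x.le y)
    (hyz : y.le z) : x.le z := by
  rcases hxy with rfl | ⟨t₁, s₁, h₁⟩
  · exact hyz
  rcases hyz with rfl | ⟨t₂, s₂, h₂⟩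
  · exact Or.inr ⟨t₁, s₁, h₁⟩
  · exact Or.inr ⟨t₁.trans t₂, s₁.trans s₂, fun ψ hψ =>
      h₂ ψ (h₁ _ (x.isMaximal.mem_of_common hC (.box4 _) hψ))⟩

theorem le_antisymm {x y : Point.{u} Ax T₀} (hxy : x.le y) (hyx : y.le x) : x = y := by
  rcases hxy with h | ⟨t₁, -⟩
  · exact h
  rcases hyx with h | ⟨t₂, -⟩
  · exact h.symm
  · omega

theorem le.side_eq {x y : Point.{u} Ax T₀} (h : x.le y) : x.side = y.side := by
  rcases h with rfl | ⟨-, h, -⟩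
  · rfl
  · exact h

theorem le.mem (hC : ∀ φ, CommonAx φ → Ax φ) {x y : Point.{u} Ax T₀} (h : x.le y) {ψ : Form P}
    (hψ : box ψ ∈ x.th) : ψ ∈ y.th := by
  rcases h with rfl | ⟨-, -, h⟩
  · exact x.isMaximal.mem_of_common hC (.boxT _) hψ
  · exact h ψ hψ

theorem isPreorder_le (hC : ∀ φ, CommonAx φ → Ax φ) :
    IsPreorder (Point.{u} Ax T₀) le where
  refl := le_refl
  trans _ _ _ := le_trans hC

theorem isPreorder_guard (hC : ∀ φ, CommonAx φ → Ax φ) (b : Bool) :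
    IsPreorder (Point.{u} Ax T₀) (guard b) where
  refl x := Or.inr (le_refl x)
  trans x y z hxy hyz := by
    rcases hyz with h | hyz
    · exact Or.inl h
    rcases hxy with h | hxy
    · exact Or.inl (hyz.side_eq ▸ h)
    · exact Or.inr (le_trans hC hxy hyz)

theorem isPreorder_support (ψ : Form P) : IsPreorder (Point.{u} Ax T₀) (support ψ) where
  refl _ := id
  trans _ _ _ h₁ h₂ := h₂ ∘ h₁

/-- The target of a step lies on one of the two sides; the guard order of the other side forces
`Point.le`. -/
theorem le_of_guard {x y : Point.{u} Ax T₀} (h : ∀ b, guard b x y) : x.le y :=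
  (h (!y.side)).resolve_left (by simp)

/-- A nontrivial step of `Point.le` is strict for the guard order of the opposite side. -/
theorem not_guard_of_le {x y : Point.{u} Ax T₀} (h : x.le y) (hne : x ≠ y) :
    ¬ guard (!x.side) y x := by
  rintro (h' | h')
  · simp at h'
  · exact hne (le_antisymm h h')

end Point

/-- The evidence of the canonical model: the trivial order, the guard orders and the orders
`Point.support ψ`. The guard orders have strictly higher priority than the other ones. -/
def canonicalFamily (hC : ∀ φ, CommonAx φ → Ax φ) (T₀ : Set (Form P)) :
    OrderedFamily (Point.{u} Ax T₀) where
  evid := insert (fun _ _ => True) (Set.range Point.guard ∪ Set.range Point.support)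
  evid_preorder := by
    rintro R (rfl | ⟨b, rfl⟩ | ⟨ψ, rfl⟩)
    · exact { refl := fun _ => trivial, trans := fun _ _ _ _ _ => trivial }
    · exact Point.isPreorder_guard hC b
    · exact Point.isPreorder_support ψ
  prio R R' := R.1 ∈ Set.range Point.guard → R'.1 ∈ Set.range Point.guard
  prio_preorder :=
    { refl := fun _ => id
      trans := fun _ _ _ h₁ h₂ => h₂ ∘ h₁ }

section Canonical

variable (hC : ∀ φ, CommonAx φ → Ax φ) (T₀ : Set (Form P))

theorem guard_mem_canonicalFamily (b : Bool) :
    Point.guard b ∈ (canonicalFamily.{u} hC T₀).evid :=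
  Or.inr (Or.inl ⟨b, rfl⟩)

theorem capRel_canonicalFamily (h : ∀ φ, Ax (imp (box0 φ) (box φ))) :
    capRel (canonicalFamily.{u} hC T₀) = Point.le := by
  ext x y
  refine ⟨fun hxy => Point.le_of_guard fun b => hxy _ (guard_mem_canonicalFamily hC T₀ b), ?_⟩
  rintro hxy R (rfl | ⟨b, rfl⟩ | ⟨ψ, rfl⟩)
  · trivial
  · exact Or.inr hxy
  · exact fun hψ => hxy.mem hC (x.isMaximal.mem_of_imp hC (.ax (h _))
      (x.isMaximal.mem_of_common hC (.box0four _) hψ))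

theorem lexRel_canonicalFamily : lexRel (canonicalFamily.{u} hC T₀) = Point.le := by
  ext x y
  constructor
  · intro hxy
    refine Point.le_of_guard fun b => ?_
    rcases hxy ⟨_, guard_mem_canonicalFamily hC T₀ b⟩ with h | ⟨R, ⟨h₁, h₂⟩, -⟩
    · exact h
    · exact absurd (fun _ => ⟨b, rfl⟩) h₂
  · intro hxy R'
    by_cases hR' : R'.1 x y
    · exact Or.inl hR'
    -- `R'` fails at a step of `Point.le`, so it is not a guard order and the step is not trivial
    have hne : x ≠ y := by
      rintro rfl
      exact hR' (((canonicalFamily hC T₀).evid_preorder _ R'.2).refl x)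
    have hguard : R'.1 ∉ Set.range Point.guard := by
      rintro ⟨b, hb⟩
      exact hR' (hb ▸ Or.inr hxy)
    exact Or.inr ⟨⟨_, guard_mem_canonicalFamily hC T₀ (!x.side)⟩,
      ⟨fun _ => ⟨_, rfl⟩, fun h => hguard (h ⟨_, rfl⟩)⟩, Or.inr hxy, Point.not_guard_of_le hxy hne⟩

/-- The canonical model based on `T₀`, for a given aggregator. -/
def canonicalModel (hT₀ : IsMaximal Ax T₀) (agg : Aggregator (Point.{u} Ax T₀)) :
    Model.{u} P where
  W := Point Ax T₀
  nonempty := ⟨⟨T₀, hT₀, fun _ => Iff.rfl, 0, true⟩⟩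
  fam := canonicalFamily hC T₀
  trivial_mem := Set.mem_insert _ _
  val p := {x | var p ∈ x.th}
  agg := agg

variable {T₀}

/-- The truth lemma, for every aggregator that sends the canonical family to `Point.le`. -/
theorem sat_canonicalModel (h0T : ∀ T φ, IsMaximal Ax T → box0 φ ∈ T → φ ∈ T)
    (hU : ∀ T φ, IsMaximal Ax T → all φ ∈ T → box φ ∈ T)
    (hT₀ : IsMaximal Ax T₀) (agg : Aggregator (Point.{u} Ax T₀))
    (hagg : (agg (canonicalFamily hC T₀)).1 = Point.le) (φ : Form P) (x : Point.{u} Ax T₀) :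
    (canonicalModel hC T₀ hT₀ agg).Sat x φ ↔ φ ∈ x.th := by
  induction φ generalizing x with
  | var p => exact Iff.rfl
  | neg φ ih => exact (not_congr (ih x)).trans (x.isMaximal.neg_mem_iff φ).symm
  | and φ ψ ih₁ ih₂ =>
    exact (and_congr (ih₁ x) (ih₂ x)).trans ((x.isMaximal.isBoolean hC).2 φ ψ).symm
  | all φ ih =>
    constructor
    · intro h
      by_contra hn
      obtain ⟨S, hS, hSx, hφS⟩ := x.isMaximal.exists_of_all_notMem hC hn
      exact hφS ((ih ⟨S, hS, fun ψ => (hSx ψ).trans (x.all_mem ψ), 0, true⟩).1 (h _))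
    · intro h y
      exact (ih y).2 (y.isMaximal.mem_of_common hC (.allT _)
        ((y.all_mem φ).2 ((x.all_mem φ).1 h)))
  | box φ ih =>
    change (∀ y, (agg (canonicalFamily hC T₀)).1 x y → _) ↔ _
    rw [hagg]
    constructor
    · intro h
      by_contra hn
      obtain ⟨S, hS, hxS, hφS⟩ := x.isMaximal.exists_of_notMem hC box .necBox .boxK hn
      have hSx := x.isMaximal.all_mem_iff hC hS fun ψ hψ => hxS ψ (hU _ _ x.isMaximal hψ)
      let y : Point Ax T₀ :=
        ⟨S, hS, fun ψ => (hSx ψ).trans (x.all_mem ψ), x.time + 1, x.side⟩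
      exact hφS ((ih y).1 (h y (Or.inr ⟨Nat.lt_succ_self _, rfl, hxS⟩)))
    · exact fun h y hxy => (ih y).2 (hxy.mem hC h)
  | box0 φ ih =>
    constructor
    · rintro ⟨R, hR, h⟩
      have h : ∀ y, R x y → φ ∈ y.th := fun y hy => (ih y).1 (h y hy)
      -- evidence that sees a copy of every world supports only universal truths
      have huniv (b : Bool) (hb : ∀ y : Point Ax T₀, y.side = b → φ ∈ y.th) :
          box0 φ ∈ x.th := by
        refine x.isMaximal.mem_of_common hC (.universality0 _) (by_contra fun hn => ?_)
        obtain ⟨S, hS, hSx, hφS⟩ := x.isMaximal.exists_of_all_notMem hC hn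
        exact hφS (hb ⟨S, hS, fun ψ => (hSx ψ).trans (x.all_mem ψ), 0, b⟩ rfl)
      rcases hR with rfl | ⟨b, rfl⟩ | ⟨ψ, rfl⟩
      · exact huniv true fun y _ => h y trivial
      · exact huniv b fun y hy => h y (Or.inl hy)
      · by_cases hψ : box0 ψ ∈ x.th
        · exact x.isMaximal.box0_mem_of_forall hC hψ fun S hS hSx hψS =>
            h ⟨S, hS, fun χ => (hSx χ).trans (x.all_mem χ), 0, true⟩ fun _ => hψS
        · exact huniv true fun y _ => h y fun h' => absurd h' hψ
    · intro h
      exact ⟨Point.support φ, Or.inr (Or.inr ⟨φ, rfl⟩), fun y hy =>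
        (ih y).2 (h0T _ _ y.isMaximal (hy h))⟩

end Canonical

/-! ### Completeness -/

/-- Strong completeness, given for every world an aggregator that sends the canonical family to
`Point.le` and puts the canonical model in the class. -/
theorem stronglyComplete_of_agg {C : Model.{u} P → Prop} (hC : ∀ φ, CommonAx φ → Ax φ)
    (h0T : ∀ T φ, IsMaximal Ax T → box0 φ ∈ T → φ ∈ T)
    (hU : ∀ T φ, IsMaximal Ax T → all φ ∈ T → box φ ∈ T)
    (hagg : ∀ T₀ (hT₀ : IsMaximal Ax T₀), ∃ agg : Aggregator (Point.{u} Ax T₀),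
      (agg (canonicalFamily hC T₀)).1 = Point.le ∧ C (canonicalModel hC T₀ hT₀ agg)) :
    StronglyComplete Ax C := by
  intro Γ φ hcons
  by_contra hn
  obtain ⟨T, hT, hΓ, hφ⟩ := exists_isMaximal hC hn
  obtain ⟨agg, hle, hmem⟩ := hagg T hT
  have hsat := sat_canonicalModel hC h0T hU hT agg hle
  let x : Point Ax T := ⟨T, hT, fun _ => Iff.rfl, 0, true⟩
  exact hφ ((hsat φ x).1 (hcons _ hmem x fun γ hγ => (hsat γ x).2 (hΓ hγ)))

theorem stronglyComplete_cap : StronglyComplete (P := P) CapAx Model.IsCap.{u} := by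
  have hbox : ∀ T φ, IsMaximal CapAx T → box0 φ ∈ T → box (P := P) φ ∈ T := fun T φ hT =>
    hT.mem_of_imp .common (.ax (.box0_box φ))
  refine stronglyComplete_of_agg .common
    (fun T φ hT h => hT.mem_of_common .common (.boxT φ) (hbox T φ hT h))
    (fun T φ hT h => hbox T φ hT (hT.mem_of_common .common (.universality0 φ) h))
    fun T₀ hT₀ => ⟨capAgg _, capRel_canonicalFamily .common T₀ .box0_box, rfl⟩

open Classical in
/-- The lexicographic rule as an aggregator; where it does not return a preorder, the
intersection rule is used instead. -/
noncomputable def lexAgg (W : Type u) : Aggregator W := fun F =>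
  if h : IsPreorder W (lexRel F) then ⟨lexRel F, h⟩ else capAgg W F

theorem lexAgg_eq {W : Type u} {F : OrderedFamily W} (h : IsPreorder W (lexRel F)) :
    (lexAgg W F).1 = lexRel F := by
  rw [lexAgg, dif_pos h]

theorem stronglyComplete_lex : StronglyComplete (P := P) LexAx Model.IsLex.{u} := by
  refine stronglyComplete_of_agg .common
    (fun T φ hT => hT.mem_of_imp .common (.ax (.box0T φ)))
    (fun T φ hT => hT.mem_of_imp .common (.ax (.universality φ))) fun T₀ hT₀ => ?_
  have hpre : IsPreorder _ (lexRel (canonicalFamily.{u} (LexAx.common (P := P)) T₀)) := by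
    rw [lexRel_canonicalFamily]
    exact Point.isPreorder_le .common
  exact ⟨lexAgg _, (lexAgg_eq hpre).trans (lexRel_canonicalFamily _ _), hpre,
    fun _ h => lexAgg_eq h⟩

end REL

theorem theorem1 {P : Type} [Countable P] [Infinite P] :
    (REL.Sound (P := P) REL.CapAx REL.Model.IsCap.{u} ∧
      REL.StronglyComplete (P := P) REL.CapAx REL.Model.IsCap.{u}) ∧
    (REL.Sound (P := P) REL.LexAx REL.Model.IsLex.{u} ∧
      REL.StronglyComplete (P := P) REL.LexAx REL.Model.IsLex.{u}) :=
  ⟨⟨REL.sound_cap, REL.stronglyComplete_cap⟩, REL.sound_lex, REL.stronglyComplete_lex⟩
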